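/- Let $\Theta$ and $\mathcal X$ be Polish spaces with their Borel $\sigma$-fields, $\Theta\neq\emptyset$, and let $\theta\mapsto P_\theta$ be a one-to-one Borel map from $\Theta$ into the space of probability measures on $\mathcal X$ (with the topology of weak convergence). Given $\theta$, the observations $X_1,X_2,\dots$ are i.i.d. with law $P_\theta$; $P_\theta^\infty$ denotes the product measure on $\mathcal X^\infty$. For a prior $q$ on $\Theta$ let $P_q(A\times B)=\int_A P_\theta^\infty(B)\,dq(\theta)$ be the joint law of parameter and data, and let $q_n$ be the posterior distribution of $\theta$ given $X_{1:n}=(X_1,\dots,X_n)$. Let $\{\Pi(\cdot\mid\lambda):\lambda\in\Lambda\}$ be a family of prior probabilities on $\Theta$, indexed by a subset $\Lambda$ of a topological space; for $\lambda_0\in\overline\Lambda\setminus\Lambda$ let $\Pi(\cdot\mid\lambda_0)$ be the weak limit of $\Pi(\cdot\mid\lambda)$ as $\lambda\to\lambda_0$ in $\Lambda$, when it exists. For each such $\lambda$ and each $n$ let $x_{1:n}\mapsto\Pi(\cdot\mid\lambda,x_{1:n})$ be a version of the posterior distribution for the prior $\Pi(\cdot\mid\lambda)$ (for instance the one given by Bayes'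 rule, if the model is dominated). Let $\hat\lambda_n=\hat\lambda_n(X_{1:n})\in\overline\Lambda$ be estimators and let $\Pi_{n,\hat\lambda_n}=\Pi(\cdot\mid\hat\lambda_n,X_{1:n})$ be the empirical Bayes (EB) posterior. It is assumed to depend measurably on $X_{1:n}$ and to be well defined: for every $\theta$, $P_\theta^\infty$-almost surely, for all large $n$ the prior $\Pi(\cdot\mid\hat\lambda_n)$ exists and $\Pi_{n,\hat\lambda_n}$ is a probability measure. The EB posterior is called consistent at $\theta$ if for every neighbourhood $W$ of $\theta$, $\Pi_{n,\hat\lambda_n}(W^c)\to0$ $P_\theta^\infty$-almost surely. Two sequences of probability measures $p_n,r_n$ on a topological space merge weakly if $|\int g\,dp_n-\int g\,dr_n|\to0$ for all bounded continuous real functions $g$. For a probability $\nu$ on $\Theta$ put $P_\nu^{\rm pred}=\int_\Theta P_\theta^\infty(\cdot)\,d\nu(\theta)$; for $\nu=q_n$ or $\nu=\Pi_{n,\hat\lambda_n}$ this is the predictive distribution of all future observations. 1. The EB posterior is consistent at every $\theta\in\Theta$ if and only if, for every prior probability $q$ on $\Theta$, with $P_q$-probability $1$ the sequences $\Pi_{n,\hat\lambda_n}$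 and $q_n$ merge weakly. 2. If moreover $\theta\mapsto P_\theta$ is a homeomorphism onto its image, then the following are equivalent: (a) the EB posterior is consistent at every $\theta\in\Theta$; (b) for every prior probability $q$ on $\Theta$, with $P_q$-probability $1$ the predictive distributions $P^{\rm pred}_{\Pi_{n,\hat\lambda_n}}$ and $P^{\rm pred}_{q_n}$ merge weakly; (c) for every prior probability $q$ on $\Theta$ and every bounded continuous $f:\mathcal X^\infty\to\mathbb R$, $\bigl|\int f\,dP^{\rm pred}_{\Pi_{n,\hat\lambda_n}}-\int f\,dP^{\rm pred}_{q_n}\bigr|\to0$ $P_q$-almost surely. -/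

import Mathlib

open MeasureTheory ProbabilityTheory Filter Topology
open scoped ENNReal BoundedContinuousFunction

noncomputable section

namespace EmpiricalBayes

section Model

variable {Θ X L : Type*}

/-- For a Borel family `θ ↦ P θ` of probability measures, the infinite product measures
`P θ ^ ∞` depend measurably on `θ`. -/
theorem measurable_infinitePi [MeasurableSpace Θ] [MeasurableSpace X]
    {P : Θ → ProbabilityMeasure X} (hP : Measurable P) :
    Measurable fun θ => Measure.infinitePi fun _ : ℕ => (P θ : Measure X) := by
  refine Measurable.measure_of_isPiSystem_of_isProbabilityMeasure
    (generateFrom_squareCylinders (ι := ℕ) (α := fun _ => X)).symm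
    (isPiSystem_squareCylinders (fun _ => MeasurableSpace.isPiSystem_measurableSet) (by simp))
    ?_
  rintro _ ⟨s, t, ht, rfl⟩
  have ht' : ∀ i, MeasurableSet (t i) := fun i => ht i (Set.mem_univ i)
  simp_rw [Measure.infinitePi_pi (fun _ : ℕ => (P _ : Measure X)) (fun i _ => ht' i)]
  refine Finset.measurable_prod _ fun i _ => ?_
  exact (Measure.measurable_coe (ht' i)).comp (measurable_subtype_coe.comp hP)

/-- The law `P θ ^ ∞` of an i.i.d. sequence `X₁, X₂, …` with common distribution `P θ`, as a
Markov kernel in `θ`. -/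
def seqKernel [MeasurableSpace Θ] [MeasurableSpace X]
    (P : Θ → ProbabilityMeasure X) (hP : Measurable P) : Kernel Θ (ℕ → X) where
  toFun θ := Measure.infinitePi fun _ : ℕ => (P θ : Measure X)
  measurable' := measurable_infinitePi hP

instance [MeasurableSpace Θ] [MeasurableSpace X]
    (P : Θ → ProbabilityMeasure X) (hP : Measurable P) : IsMarkovKernel (seqKernel P hP) :=
  ⟨fun θ => inferInstanceAs
    (IsProbabilityMeasure (Measure.infinitePi fun _ : ℕ => (P θ : Measure X)))⟩

/-- The first `n` observations `(x₁, …, xₙ)` of a sequence. -/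
def initialData (n : ℕ) (x : ℕ → X) : Fin n → X := fun i => x i

theorem measurable_initialData [MeasurableSpace X] (n : ℕ) :
    Measurable (initialData n : (ℕ → X) → Fin n → X) :=
  measurable_pi_lambda _ fun i => measurable_pi_apply (i : ℕ)

/-- The law of the first `n` observations given `θ`. -/
def sampleKernel [MeasurableSpace Θ] [MeasurableSpace X]
    (P : Θ → ProbabilityMeasure X) (hP : Measurable P) (n : ℕ) : Kernel Θ (Fin n → X) :=
  (seqKernel P hP).map (initialData n)

instance [MeasurableSpace Θ] [MeasurableSpace X]
    (P : Θ → ProbabilityMeasure X) (hP : Measurable P) (n : ℕ) :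
    IsMarkovKernel (sampleKernel P hP n) :=
  Kernel.IsMarkovKernel.map _ (measurable_initialData n)

/-- The joint law of the parameter and the data under a prior `q`:
`P_q (A × B) = ∫_A P θ ^ ∞ (B) dq(θ)`. -/
def jointLaw [MeasurableSpace Θ] [MeasurableSpace X]
    (P : Θ → ProbabilityMeasure X) (hP : Measurable P) (q : Measure Θ) :
    Measure (Θ × (ℕ → X)) :=
  q ⊗ₘ seqKernel P hP

/-- The predictive law `∫ P θ ^ ∞ dν(θ)` of all future observations, when `ν` is the current
distribution of the parameter. -/
def predictive [MeasurableSpace Θ] [MeasurableSpace X]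
    (P : Θ → ProbabilityMeasure X) (hP : Measurable P) (ν : Measure Θ) : Measure (ℕ → X) :=
  seqKernel P hP ∘ₘ ν

/-- The Bayes posterior of `θ` given the first `n` observations, for the prior `q`
(a regular conditional distribution). -/
def bayesPosterior [MeasurableSpace Θ] [StandardBorelSpace Θ] [Nonempty Θ] [MeasurableSpace X]
    (P : Θ → ProbabilityMeasure X) (hP : Measurable P) (q : Measure Θ) [IsFiniteMeasure q]
    (n : ℕ) (x : Fin n → X) : Measure Θ :=
  posterior (sampleKernel P hP n) q x

/-- `η` is a version of the posterior of `θ` given the first `n` observations, for the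
prior `q`. Posteriors are unique up to a null set of the marginal law of the data. -/
def IsPosteriorVersion [MeasurableSpace Θ] [StandardBorelSpace Θ] [Nonempty Θ]
    [MeasurableSpace X] (P : Θ → ProbabilityMeasure X) (hP : Measurable P)
    (q : Measure Θ) [IsFiniteMeasure q] (n : ℕ) (η : (Fin n → X) → Measure Θ) : Prop :=
  ∀ᵐ x ∂(sampleKernel P hP n ∘ₘ q), η x = bayesPosterior P hP q n x

/-- Bayes' rule in a dominated model with densities `p θ`:
`B ↦ ∫_B p θ x dq(θ) / ∫ p θ x dq(θ)`. -/
def bayesRule [MeasurableSpace Θ] {n : ℕ} (p : Θ → (Fin n → X) → ℝ≥0∞) (q : Measure Θ)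
    (x : Fin n → X) : Measure Θ :=
  (∫⁻ θ, p θ x ∂q)⁻¹ • q.withDensity fun θ => p θ x

/-- In a dominated model, Bayes' rule is a version of the posterior, for every prior. -/
theorem isPosteriorVersion_bayesRule [MeasurableSpace Θ] [StandardBorelSpace Θ] [Nonempty Θ]
    [MeasurableSpace X] (P : Θ → ProbabilityMeasure X) (hP : Measurable P)
    (q : Measure Θ) [IsFiniteMeasure q] {n : ℕ} (μ : Measure (Fin n → X)) [SigmaFinite μ]
    (p : Θ → (Fin n → X) → ℝ≥0∞) (hp : Measurable (Function.uncurry p))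
    (hdom : ∀ θ, sampleKernel P hP n θ = μ.withDensity (p θ)) :
    IsPosteriorVersion P hP q n (bayesRule p q) := by
  set κ := sampleKernel P hP n with hκ
  set D : (Fin n → X) → ℝ≥0∞ := fun x => ∫⁻ θ, p θ x ∂q with hDdef
  have hpB : ∀ B : Set Θ, Measurable fun x => ∫⁻ θ in B, p θ x ∂q := fun B =>
    Measurable.lintegral_prod_right' (f := fun z : (Fin n → X) × Θ => p z.2 z.1)
      (hp.comp measurable_swap)
  have hD : Measurable D := by simpa only [hDdef, Measure.restrict_univ] using hpB Set.univ
  have hval : ∀ x B, MeasurableSet B → bayesRule p q x B = (D x)⁻¹ * ∫⁻ θ in B, p θ x ∂q := by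
    intro x B hB
    simp [bayesRule, withDensity_apply _ hB, hDdef]
  have hm : κ ∘ₘ q = μ.withDensity D := by
    ext C hC
    rw [Measure.bind_apply hC κ.aemeasurable, withDensity_apply _ hC]
    simp_rw [hdom, withDensity_apply _ hC]
    exact lintegral_lintegral_swap hp.aemeasurable
  have hDfin : ∀ᵐ x ∂μ, D x < ∞ := by
    refine ae_lt_top hD ?_
    have : (μ.withDensity D) Set.univ ≠ ∞ := by rw [← hm]; exact measure_ne_top _ _
    simpa using this
  let η : Kernel (Fin n → X) Θ :=
    ⟨bayesRule p q, Measure.measurable_of_measurable_coe _ fun B hB => by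
      simp_rw [hval _ B hB]
      exact hD.inv.mul (hpB B)⟩
  have hη : ∀ x, η x = bayesRule p q x := fun _ => rfl
  have : IsFiniteKernel η := ⟨⟨1, ENNReal.one_lt_top, fun x => by
    rw [hη, hval x _ MeasurableSet.univ]
    simp [hDdef]⟩⟩
  refine ae_eq_posterior_of_compProd_eq (η := η) ?_
  refine Measure.ext_prod fun {C B} hC hB => ?_
  rw [Measure.compProd_apply_prod hC hB, Measure.map_apply measurable_swap (hC.prod hB),
    Set.preimage_swap_prod, Measure.compProd_apply_prod hB hC, hm]
  simp_rw [hη, hval _ B hB]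
  simp_rw [← hκ, hdom, withDensity_apply _ hC]
  have hG : Measurable fun x => (D x)⁻¹ * ∫⁻ θ in B, p θ x ∂q := hD.inv.mul (hpB B)
  rw [setLIntegral_withDensity_eq_setLIntegral_mul _ hD hG hC,
    lintegral_lintegral_swap hp.aemeasurable]
  refine lintegral_congr_ae (ae_restrict_of_ae ?_)
  filter_upwards [hDfin] with x hx
  by_cases h0 : D x = 0
  · have : ∫⁻ θ in B, p θ x ∂q = 0 :=
      le_antisymm ((setLIntegral_le_lintegral _ _).trans_eq h0) bot_le
    simp [h0, this]
  · simp [← mul_assoc, ENNReal.mul_inv_cancel h0 hx.ne]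

/-- The prior attached to a hyperparameter value `l`: the given prior `Pr l` if `l ∈ Λ`, and the
weak limit of `Pr l'` as `l' → l` within `Λ` (if this limit exists) if `l` lies in the closure of
`Λ` but not in `Λ`. -/
def IsPriorAt [TopologicalSpace L] [TopologicalSpace Θ] [MeasurableSpace Θ]
    [OpensMeasurableSpace Θ] (Λ : Set L) (Pr : Λ → ProbabilityMeasure Θ)
    (l : L) (ν : ProbabilityMeasure Θ) : Prop :=
  (∃ h : l ∈ Λ, Pr ⟨l, h⟩ = ν) ∨
    (l ∉ Λ ∧ l ∈ closure Λ ∧ Tendsto Pr (comap Subtype.val (𝓝 l)) (𝓝 ν))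

/-- The empirical Bayes posterior given `x₁, …, xₙ`: the estimate `lhat n (x₁, …, xₙ)` of the
hyperparameter is plugged into the posterior. -/
def ebPosterior [TopologicalSpace L] [MeasurableSpace Θ] {Λ : Set L}
    (post : ∀ n : ℕ, closure Λ → (Fin n → X) → Measure Θ)
    (lhat : ∀ n : ℕ, (Fin n → X) → closure Λ) (n : ℕ) (x : Fin n → X) : Measure Θ :=
  post n (lhat n x) x

/-- A sequence of (data-dependent) distributions on the parameter space is weakly consistent
at `θ`: for each neighbourhood `W` of `θ`, the mass of `Wᶜ` tends to `0`, `P θ ^ ∞`-almost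
surely. -/
def WeaklyConsistentAt [TopologicalSpace Θ] [MeasurableSpace Θ] [MeasurableSpace X]
    (P : Θ → ProbabilityMeasure X) (hP : Measurable P)
    (post : ∀ n : ℕ, (Fin n → X) → Measure Θ) (θ : Θ) : Prop :=
  ∀ W ∈ 𝓝 θ, ∀ᵐ x ∂(seqKernel P hP θ),
    Tendsto (fun n => post n (initialData n x) Wᶜ) atTop (𝓝 0)

/-- Two sequences of measures merge weakly: `|∫ g dp_n - ∫ g dq_n| → 0` for every bounded
continuous `g`. -/
def WeaklyMerge {S : Type*} [TopologicalSpace S] [MeasurableSpace S]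
    (p q : ℕ → Measure S) : Prop :=
  ∀ g : S →ᵇ ℝ, Tendsto (fun n => |∫ s, g s ∂(p n) - ∫ s, g s ∂(q n)|) atTop (𝓝 0)

end Model

end EmpiricalBayes

end

open EmpiricalBayes

/-! Doob's theorem (`ae_concentratesAt_bayesPosterior`) says that for every prior `q` the Bayes
posterior converges weakly to the Dirac mass at the parameter, almost surely under the joint law.
Merging with it therefore amounts to weak convergence of the EB posterior to the same Dirac mass.
Consistency at every `θ` yields this by Fubini; conversely, the prior `dirac θ` turns joint-law
statements into statements at `θ`.

For predictive laws, the expectation of `f` under `P t ^ ∞` is bounded and continuous in `t`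
(`continuous_infinitePower`), so weak convergence on `Θ` carries over. For the way back, with `c`
the mean of `k` under `P θ`, the function `(k x₀ - c) (k x₁ - c)` has expectation `(∫ k dP_t - c)²`
by independence (`integral_centeredProduct`). This is nonnegative in `t` and vanishes at `θ`, so
Markov's inequality drives the mass out of `{t | ε ≤ |∫ k dP_t - c|}`. Since `P` is inducing, the
complements of such sets generate the neighbourhoods of `θ`. -/

namespace EmpiricalBayes

/-! ### Recovering the parameter from the data, and Doob's theorem for events. -/

section Doob

variable {Θ X : Type*} [MeasurableSpace Θ] [MeasurableSpace X]

/-- The relative frequency of visits to `B` among the first `n` terms of `x`. -/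
noncomputable def frequency (B : Set X) (n : ℕ) (x : ℕ → X) : ℝ :=
  (∑ i ∈ Finset.range n, B.indicator (fun _ => (1 : ℝ)) (x i)) / n

theorem measurable_frequency {B : Set X} (hB : MeasurableSet B) (n : ℕ) :
    Measurable (frequency B n) :=
  (Finset.measurable_sum _ fun i _ =>
    (measurable_const.indicator hB).comp (measurable_pi_apply i)).div_const _

theorem ae_tendsto_frequency (P : Θ → ProbabilityMeasure X) (hP : Measurable P) (θ : Θ)
    {B : Set X} (hB : MeasurableSet B) :
    ∀ᵐ x ∂(seqKernel P hP θ),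
      Tendsto (fun n => frequency B n x) atTop (𝓝 ((P θ : Measure X).real B)) := by
  have hf : Measurable (B.indicator fun _ => (1 : ℝ)) := measurable_const.indicator hB
  have hmp : ∀ i, MeasurePreserving (Function.eval i) (seqKernel P hP θ) (P θ : Measure X) :=
    fun i => measurePreserving_eval_infinitePi (fun _ : ℕ => (P θ : Measure X)) i
  have hint : Integrable (B.indicator fun _ => (1 : ℝ)) (P θ : Measure X) :=
    (integrable_const _).indicator hB
  have h := strong_law_ae_real (μ := seqKernel P hP θ)
    (fun i x => B.indicator (fun _ => (1 : ℝ)) (x i))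
    ((hmp 0).integrable_comp_of_integrable hint) ?_ ?_
  · have heq : ∫ x, B.indicator (fun _ => (1 : ℝ)) (x 0) ∂(seqKernel P hP θ) =
        (P θ : Measure X).real B := by
      rw [← integral_indicator_one hB, ← (hmp 0).map_eq,
        integral_map (measurable_pi_apply 0).aemeasurable
          (measurable_const.indicator hB).aestronglyMeasurable]
      rfl
    rw [heq] at h
    exact h
  · intro i j hij
    exact (iIndepFun_infinitePi (P := fun _ : ℕ => (P θ : Measure X))
      (X := fun _ => B.indicator fun _ => (1 : ℝ)) fun _ => hf).indepFun hij
  · intro i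
    refine ⟨(hf.comp (measurable_pi_apply i)).aemeasurable,
      (hf.comp (measurable_pi_apply 0)).aemeasurable, ?_⟩
    change Measure.map ((B.indicator fun _ => (1 : ℝ)) ∘ fun x : ℕ → X => x i) _ =
      Measure.map ((B.indicator fun _ => (1 : ℝ)) ∘ fun x : ℕ → X => x 0) _
    rw [← Measure.map_map hf (measurable_pi_apply i), ← Measure.map_map hf (measurable_pi_apply 0)]
    exact congrArg _ ((hmp i).map_eq.trans (hmp 0).map_eq.symm)

/-- In an identifiable model the parameter is a measurable function of the whole sequence of
observations. -/
theorem exists_measurable_parameter [StandardBorelSpace Θ] [Nonempty Θ] [StandardBorelSpace X]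
    (P : Θ → ProbabilityMeasure X) (hP : Measurable P) (hinj : Function.Injective P) :
    ∃ T : (ℕ → X) → Θ, Measurable T ∧ ∀ θ, ∀ᵐ x ∂(seqKernel P hP θ), T x = θ := by
  -- A Borel embedding into `ℝ` supplies a distribution function; its values at rationals are
  -- countably many statistics that determine `P θ`.
  have he := measurableEmbedding_embeddingReal X
  set B : ℚ → Set X := fun r => embeddingReal X ⁻¹' Set.Iic (r : ℝ) with hBdef
  have hB : ∀ r, MeasurableSet (B r) := fun r => he.measurable measurableSet_Iic
  set F : Θ → ℚ → ℝ := fun θ r => (P θ : Measure X).real (B r) with hFdef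
  have hF : Measurable F := measurable_pi_lambda _ fun r =>
    ((Measure.measurable_coe (hB r)).comp (measurable_subtype_coe.comp hP)).ennreal_toReal
  have hFinj : Function.Injective F := by
    intro θ θ' h
    refine hinj (Subtype.ext ?_)
    have hmap : (P θ : Measure X).map (embeddingReal X) =
        (P θ' : Measure X).map (embeddingReal X) := by
      have := Measure.isProbabilityMeasure_map (μ := (P θ : Measure X)) he.measurable.aemeasurable
      have := Measure.isProbabilityMeasure_map (μ := (P θ' : Measure X)) he.measurable.aemeasurable
      refine ext_of_generate_finite _
        ((BorelSpace.measurable_eq (α := ℝ)).trans Real.borel_eq_generateFrom_Iic_rat)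
        Real.isPiSystem_Iic_rat ?_ (by simp)
      intro s hs
      obtain ⟨r, rfl⟩ := Set.mem_iUnion.1 hs
      rw [Measure.map_apply he.measurable measurableSet_Iic,
        Measure.map_apply he.measurable measurableSet_Iic]
      exact (measureReal_eq_measureReal_iff).1 (congrFun h r)
    have := congrArg (Measure.comap (embeddingReal X)) hmap
    rwa [he.comap_map, he.comap_map] at this
  -- Lusin–Souslin: an injective Borel map out of a standard Borel space has a measurable inverse on
  -- its range.
  have hemb : MeasurableEmbedding F := hF.measurableEmbedding hFinj
  -- The `limsup` is measurable in `x` even where the frequencies diverge.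
  refine ⟨fun x => hemb.invFun fun r => limsup (fun n => frequency (B r) n x) atTop,
    hemb.measurable_invFun.comp (measurable_pi_lambda _ fun r =>
      Measurable.limsup fun n => measurable_frequency (hB r) n), fun θ => ?_⟩
  filter_upwards [ae_all_iff.2 fun r => ae_tendsto_frequency P hP θ (hB r)] with x hx
  have : (fun r => limsup (fun n => frequency (B r) n x) atTop) = F θ :=
    funext fun r => (hx r).limsup_eq
  rw [this]
  exact hemb.leftInverse_invFun θ

/-- The information contained in the first `n` observations. -/
def dataFiltration (Θ X : Type*) [MeasurableSpace Θ] [mX : MeasurableSpace X] :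
    Filtration ℕ (inferInstance : MeasurableSpace (Θ × (ℕ → X))) where
  seq n := MeasurableSpace.comap (fun z : Θ × (ℕ → X) => initialData n z.2) inferInstance
  mono' m n hmn := by
    have : (fun z : Θ × (ℕ → X) => initialData m z.2) =
        (fun y : Fin n → X => fun i : Fin m => y (Fin.castLE hmn i)) ∘
          fun z : Θ × (ℕ → X) => initialData n z.2 := rfl
    dsimp only
    rw [this, ← MeasurableSpace.comap_comp]
    exact MeasurableSpace.comap_mono (Measurable.comap_le (by fun_prop))
  le' n := ((measurable_initialData n).comp measurable_snd).comap_le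

/-- Coordinate `i` is the last entry of the first `i + 1` observations, so each coordinate is seen
at a finite time. -/
theorem measurable_snd_iSup_dataFiltration :
    @Measurable _ _ (⨆ n, (dataFiltration Θ X) n) _ (Prod.snd : Θ × (ℕ → X) → ℕ → X) := by
  refine @measurable_pi_lambda _ _ _ (_) _ _ fun i => ?_
  have h : @Measurable _ _ ((dataFiltration Θ X) (i + 1)) _
      (fun z : Θ × (ℕ → X) => initialData (i + 1) z.2) := comap_measurable _
  exact ((measurable_pi_apply (Fin.last i)).comp h).mono (le_iSup _ (i + 1)) le_rfl

/-- Both sides disintegrate the same joint law of data and parameter. This form links the posterior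
to conditional expectations. -/
theorem bayesPosterior_eq_condDistrib [StandardBorelSpace Θ] [Nonempty Θ]
    (P : Θ → ProbabilityMeasure X) (hP : Measurable P) (q : Measure Θ) [IsProbabilityMeasure q]
    [IsFiniteMeasure (jointLaw P hP q)] (n : ℕ) (x : Fin n → X) :
    bayesPosterior P hP q n x =
      condDistrib Prod.fst (fun z => initialData n z.2) (jointLaw P hP q) x := by
  have : (q ⊗ₘ sampleKernel P hP n).map Prod.swap =
      (jointLaw P hP q).map fun z => (initialData n z.2, z.1) := by
    rw [sampleKernel, Measure.compProd_map (measurable_initialData n),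
      Measure.map_map measurable_swap (by have := measurable_initialData (X := X) n; fun_prop)]
    rfl
  simp only [bayesPosterior, posterior, condDistrib, this]

instance (P : Θ → ProbabilityMeasure X) (hP : Measurable P) (q : Measure Θ)
    [IsProbabilityMeasure q] : IsProbabilityMeasure (jointLaw P hP q) := by
  unfold jointLaw; infer_instance

instance [StandardBorelSpace Θ] [Nonempty Θ]
    (P : Θ → ProbabilityMeasure X) (hP : Measurable P) (q : Measure Θ) [IsProbabilityMeasure q]
    (n : ℕ) (x : Fin n → X) : IsProbabilityMeasure (bayesPosterior P hP q n x) := by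
  rw [bayesPosterior_eq_condDistrib]; infer_instance

/-- **Doob's theorem**: posterior probabilities of an event converge to its indicator. -/
theorem ae_tendsto_bayesPosterior_real [StandardBorelSpace Θ] [Nonempty Θ] [StandardBorelSpace X]
    (P : Θ → ProbabilityMeasure X) (hP : Measurable P) (hinj : Function.Injective P)
    (q : Measure Θ) [IsProbabilityMeasure q] {B : Set Θ} (hB : MeasurableSet B) :
    ∀ᵐ z ∂(jointLaw P hP q),
      Tendsto (fun n => (bayesPosterior P hP q n (initialData n z.2)).real B) atTop
        (𝓝 (B.indicator (fun _ => 1) z.1)) := by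
  obtain ⟨T, hT, hTae⟩ := exists_measurable_parameter P hP hinj
  set g : Θ × (ℕ → X) → ℝ := (Prod.fst ⁻¹' B).indicator fun _ => 1
  set g' : Θ × (ℕ → X) → ℝ := fun z => B.indicator (fun _ => 1) (T z.2)
  -- The indicator of the parameter event is a.e. a function of the whole data sequence, so Lévy's
  -- upward theorem returns the indicator itself as the limit.
  have hgg' : g =ᵐ[jointLaw P hP q] g' := by
    have : ∀ᵐ z ∂(jointLaw P hP q), T z.2 = z.1 :=
      (Measure.ae_compProd_iff (measurableSet_eq_fun (hT.comp measurable_snd) measurable_fst)).2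
        (ae_of_all _ hTae)
    filter_upwards [this] with z hz
    simp only [g, g', hz]
    rfl
  have hg : Integrable g (jointLaw P hP q) :=
    (integrable_const _).indicator (measurable_fst hB)
  have hg' : Integrable g' (jointLaw P hP q) := hg.congr hgg'
  have hsm : StronglyMeasurable[⨆ n, (dataFiltration Θ X) n] g' :=
    (((measurable_const.indicator hB).comp hT).comp
      measurable_snd_iSup_dataFiltration).stronglyMeasurable
  have hcond : ∀ n, (fun z => (bayesPosterior P hP q n (initialData n z.2)).real B)
      =ᵐ[jointLaw P hP q] (jointLaw P hP q)[g' | dataFiltration Θ X n] := by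
    intro n
    simp_rw [bayesPosterior_eq_condDistrib]
    exact (condDistrib_ae_eq_condExp ((measurable_initialData n).comp measurable_snd)
      measurable_fst hB).trans (condExp_congr_ae hgg')
  filter_upwards [hg'.tendsto_ae_condExp hsm, ae_all_iff.2 hcond, hgg'] with z h1 h2 h3
  rw [← h3] at h1
  exact h1.congr fun n => (h2 n).symm

end Doob

/-! ### Concentration at a point and weak convergence to a Dirac mass. -/

section Concentration

variable {Θ : Type*} [TopologicalSpace Θ] [MeasurableSpace Θ]

/-- The measures `ν n` concentrate at `θ`. -/
def ConcentratesAt (ν : ℕ → Measure Θ) (θ : Θ) : Prop :=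
  ∀ W ∈ 𝓝 θ, Tendsto (fun n => ν n Wᶜ) atTop (𝓝 0)

/-- Reduces all neighbourhoods to countably many, so that a single null set suffices in almost sure
statements. -/
theorem concentratesAt_of_countableBasis [SecondCountableTopology Θ] {ν : ℕ → Measure Θ} {θ : Θ}
    (h : ∀ U ∈ TopologicalSpace.countableBasis Θ, θ ∈ U →
      Tendsto (fun n => ν n Uᶜ) atTop (𝓝 0)) : ConcentratesAt ν θ := by
  intro W hW
  obtain ⟨U, hU, hθU, hUW⟩ :=
    (TopologicalSpace.isBasis_countableBasis Θ).mem_nhds_iff.1 hW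
  exact tendsto_of_tendsto_of_tendsto_of_le_of_le tendsto_const_nhds (h U hU hθU)
    (fun _ => zero_le) fun n => measure_mono (Set.compl_subset_compl.2 hUW)

/-- Concentrating probability measures converge weakly to a Dirac mass. -/
theorem ConcentratesAt.tendsto_integral [OpensMeasurableSpace Θ] {ν : ℕ → Measure Θ} {θ : Θ}
    (h : ConcentratesAt ν θ) (hν : ∀ᶠ n in atTop, IsProbabilityMeasure (ν n)) (g : Θ →ᵇ ℝ) :
    Tendsto (fun n => ∫ t, g t ∂(ν n)) atTop (𝓝 (g θ)) := by
  rw [Metric.tendsto_nhds]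
  intro ε hε
  -- On `W` the error is below `ε / 2`; off `W` it is at most `2 * ‖g‖`, and the mass there
  -- vanishes.
  set W : Set Θ := {t | dist (g t) (g θ) < ε / 2} with hWdef
  have hWo : IsOpen W := isOpen_lt (g.continuous.dist continuous_const) continuous_const
  have hW : W ∈ 𝓝 θ := hWo.mem_nhds (by simp [hWdef, hε])
  have hreal : Tendsto (fun n => 2 * ‖g‖ * (ν n).real Wᶜ) atTop (𝓝 0) := by
    simpa [Measure.real] using
      ((ENNReal.tendsto_toReal ENNReal.zero_ne_top).comp (h W hW)).const_mul (2 * ‖g‖)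
  filter_upwards [hν, hreal.eventually (gt_mem_nhds (half_pos hε))] with n hn hlt
  have hsub : ∫ t, g t ∂(ν n) - g θ = ∫ t, (g t - g θ) ∂(ν n) := by
    rw [integral_sub (g.integrable _) (integrable_const _)]; simp
  have hbound : ∀ t, ‖g t - g θ‖ ≤ ε / 2 + Wᶜ.indicator (fun _ => 2 * ‖g‖) t := by
    intro t
    by_cases ht : t ∈ W
    · simpa [ht, ← Real.dist_eq] using (show dist (g t) (g θ) < ε / 2 from ht).le
    · have := g.dist_le_two_norm t θ
      rw [Set.indicator_of_mem (show t ∈ Wᶜ from ht), ← dist_eq_norm]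
      linarith
  have hint : Integrable (Wᶜ.indicator fun _ => 2 * ‖g‖) (ν n) :=
    (integrable_const _).indicator hWo.measurableSet.compl
  rw [dist_eq_norm, hsub]
  calc ‖∫ t, (g t - g θ) ∂(ν n)‖
      ≤ ∫ t, (ε / 2 + Wᶜ.indicator (fun _ => 2 * ‖g‖) t) ∂(ν n) :=
        norm_integral_le_of_norm_le ((integrable_const _).add hint) (ae_of_all _ hbound)
    _ = ε / 2 + 2 * ‖g‖ * (ν n).real Wᶜ := by
        rw [integral_add (integrable_const _) hint,
          integral_indicator hWo.measurableSet.compl]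
        simp [mul_comm]
    _ < ε := by linarith

/-- Markov's inequality along a sequence: if `∫ g dν n → 0` for some nonnegative bounded continuous
`g` which is bounded below by `c > 0` on `s`, then `ν n s → 0`. -/
theorem tendsto_measure_zero_of_tendsto_integral [OpensMeasurableSpace Θ] {ν : ℕ → Measure Θ}
    (hν : ∀ᶠ n in atTop, IsProbabilityMeasure (ν n)) (g : Θ →ᵇ ℝ) (hg : ∀ t, 0 ≤ g t)
    {s : Set Θ} {c : ℝ} (hc : 0 < c) (hs : ∀ t ∈ s, c ≤ g t)
    (h : Tendsto (fun n => ∫ t, g t ∂(ν n)) atTop (𝓝 0)) :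
    Tendsto (fun n => ν n s) atTop (𝓝 0) := by
  have hlim : Tendsto (fun n => ENNReal.ofReal (c⁻¹ * ∫ t, g t ∂(ν n))) atTop (𝓝 0) := by
    simpa using ENNReal.tendsto_ofReal (h.const_mul c⁻¹)
  refine tendsto_of_tendsto_of_tendsto_of_le_of_le' tendsto_const_nhds hlim
    (Eventually.of_forall fun _ => zero_le) ?_
  filter_upwards [hν] with n hn
  refine (measure_mono (show s ⊆ {t | c ≤ g t} from hs)).trans ?_
  have := mul_meas_ge_le_integral_of_nonneg (ae_of_all (ν n) hg) (g.integrable _) c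
  rw [← ofReal_measureReal]
  refine ENNReal.ofReal_le_ofReal ?_
  rwa [le_inv_mul_iff₀ hc]

end Concentration

/-! ### Passing between the joint law and the laws of the data at fixed parameters. -/

section Consistency

variable {Θ X : Type*} [MeasurableSpace Θ] [MeasurableSpace X]

/-- **Doob's consistency theorem**. -/
theorem ae_concentratesAt_bayesPosterior
    [TopologicalSpace Θ] [PolishSpace Θ] [BorelSpace Θ] [Nonempty Θ]
    [StandardBorelSpace X]
    (P : Θ → ProbabilityMeasure X) (hP : Measurable P) (hinj : Function.Injective P)
    (q : Measure Θ) [IsProbabilityMeasure q] :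
    ∀ᵐ z ∂(jointLaw P hP q),
      ConcentratesAt (fun n => bayesPosterior P hP q n (initialData n z.2)) z.1 := by
  have hall : ∀ᵐ z ∂(jointLaw P hP q), ∀ U ∈ TopologicalSpace.countableBasis Θ,
      Tendsto (fun n => (bayesPosterior P hP q n (initialData n z.2)).real Uᶜ) atTop
        (𝓝 (Uᶜ.indicator (fun _ => 1) z.1)) := by
    refine (ae_ball_iff (TopologicalSpace.countable_countableBasis Θ)).2 fun U hU => ?_
    exact ae_tendsto_bayesPosterior_real P hP hinj q
      (TopologicalSpace.isOpen_of_mem_countableBasis hU).measurableSet.compl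
  filter_upwards [hall] with z hz
  refine concentratesAt_of_countableBasis fun U hU hzU => ?_
  have := hz U hU
  rw [Set.indicator_of_notMem (by simpa using hzU)] at this
  simpa using ENNReal.tendsto_ofReal this

/-- Pointwise consistency implies concentration at the parameter, almost surely under the joint
law. -/
theorem ae_concentratesAt_of_weaklyConsistentAt
    [TopologicalSpace Θ] [SecondCountableTopology Θ] [OpensMeasurableSpace Θ]
    (P : Θ → ProbabilityMeasure X) (hP : Measurable P) (q : Measure Θ) [IsProbabilityMeasure q]
    {post : ∀ n : ℕ, (Fin n → X) → Measure Θ} (hmeas : ∀ n, Measurable (post n))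
    (h : ∀ θ, WeaklyConsistentAt P hP post θ) :
    ∀ᵐ z ∂(jointLaw P hP q), ConcentratesAt (fun n => post n (initialData n z.2)) z.1 := by
  have hall : ∀ᵐ z ∂(jointLaw P hP q), ∀ U ∈ TopologicalSpace.countableBasis Θ,
      z.1 ∈ U → Tendsto (fun n => post n (initialData n z.2) Uᶜ) atTop (𝓝 0) := by
    refine (ae_ball_iff (TopologicalSpace.countable_countableBasis Θ)).2 fun U hU => ?_
    have hUo := TopologicalSpace.isOpen_of_mem_countableBasis hU
    -- Checking the event fibre by fibre in `θ` requires it to be measurable in the product.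
    have hlim : MeasurableSet {z : Θ × (ℕ → X) |
        Tendsto (fun n => post n (initialData n z.2) Uᶜ) atTop (𝓝 0)} :=
      measurableSet_tendsto _ fun n => (Measure.measurable_coe hUo.measurableSet.compl).comp
        ((hmeas n).comp ((measurable_initialData n).comp measurable_snd))
    refine (Measure.ae_compProd_iff ?_).2 (ae_of_all _ fun θ => ?_)
    · exact (measurable_fst hUo.measurableSet).imp hlim
    · by_cases hθ : θ ∈ U
      · filter_upwards [h θ U (hUo.mem_nhds hθ)] with x hx _ using hx
      · exact ae_of_all _ fun x hx => absurd hx hθ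
  filter_upwards [hall] with z hz
  exact concentratesAt_of_countableBasis hz

theorem ae_eventually_isProbabilityMeasure (P : Θ → ProbabilityMeasure X) (hP : Measurable P)
    (q : Measure Θ) [IsProbabilityMeasure q]
    {post : ∀ n : ℕ, (Fin n → X) → Measure Θ} (hmeas : ∀ n, Measurable (post n))
    (h : ∀ θ, ∀ᵐ x ∂(seqKernel P hP θ),
      ∀ᶠ n in atTop, IsProbabilityMeasure (post n (initialData n x))) :
    ∀ᵐ z ∂(jointLaw P hP q), ∀ᶠ n in atTop, IsProbabilityMeasure (post n (initialData n z.2)) := by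
  refine (Measure.ae_compProd_iff ?_).2 (ae_of_all _ h)
  simp only [isProbabilityMeasure_iff, eventually_atTop, Set.ofPred_exists, Set.ofPred_forall]
  refine MeasurableSet.iUnion fun N => MeasurableSet.iInter fun n => MeasurableSet.iInter fun _ => ?_
  exact (Measure.measurable_coe MeasurableSet.univ).comp
    ((hmeas n).comp ((measurable_initialData n).comp measurable_snd))
    (measurableSet_singleton 1)

/-- Under a Dirac prior the only fibre of the joint law that matters is the one over `θ`. -/
theorem ae_seqKernel_of_ae_jointLaw_dirac [MeasurableSingletonClass Θ] (P : Θ → ProbabilityMeasure X) (hP : Measurable P)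
    (θ : Θ) {p : Θ × (ℕ → X) → Prop} (h : ∀ᵐ z ∂(jointLaw P hP (Measure.dirac θ)), p z) :
    ∀ᵐ x ∂(seqKernel P hP θ), p (θ, x) := by
  have := Measure.ae_ae_of_ae_compProd h
  rwa [ae_dirac_eq] at this

end Consistency

/-! ### Infinite powers and predictive expectations. -/

section Predictive

variable {Θ X : Type*} [MeasurableSpace Θ] [TopologicalSpace X] [MeasurableSpace X] [BorelSpace X]

/-- The infinite power `μ ^ ∞` of a probability measure. -/
noncomputable def infinitePower (μ : ProbabilityMeasure X) : ProbabilityMeasure (ℕ → X) :=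
  ⟨Measure.infinitePi fun _ : ℕ => (μ : Measure X), inferInstance⟩

/-- Infinite powers of probability measures depend continuously on the measure. -/
theorem continuous_infinitePower [SecondCountableTopology X]
    [TopologicalSpace.PseudoMetrizableSpace X] {S : Type*} [TopologicalSpace S]
    [FirstCountableTopology S] {P : S → ProbabilityMeasure X} (hP : Continuous P) :
    Continuous fun s => infinitePower (P s) := by
  refine continuous_iff_continuousAt.2 fun θ => ?_
  let : PseudoMetricSpace X := TopologicalSpace.pseudoMetrizableSpacePseudoMetric X
  -- Finite-dimensional boxes whose sides are continuity sets of `P θ`: a π-system containing small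
  -- neighbourhoods of each point, on which convergence reduces to finite products. Sides equal to
  -- `univ` off `I` let boxes with different index sets be intersected.
  set C : Set (Set (ℕ → X)) := {t | ∃ (I : Finset ℕ) (s : ℕ → Set X), t = Set.pi I s ∧
    (∀ i ∉ I, s i = Set.univ) ∧ (∀ i, MeasurableSet (s i)) ∧
    ∀ i, (P θ : Measure X) (frontier (s i)) = 0} with hC
  have hpi : IsPiSystem C := by
    rintro _ ⟨I, s, rfl, hI, hs, hs0⟩ _ ⟨J, t, rfl, hJ, ht, ht0⟩ -
    refine ⟨I ∪ J, fun i => s i ∩ t i, ?_, ?_, fun i => (hs i).inter (ht i),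
      fun i => null_frontier_inter (hs0 i) (ht0 i)⟩
    · ext x
      simp only [Set.mem_inter_iff, Set.mem_pi, Finset.mem_coe, Finset.mem_union]
      refine ⟨fun ⟨h1, h2⟩ i _ => ⟨?_, ?_⟩, fun h => ⟨fun i hi => (h i (.inl hi)).1,
        fun i hi => (h i (.inr hi)).2⟩⟩
      · by_cases hi : i ∈ I
        · exact h1 i hi
        · simp [hI i hi]
      · by_cases hi : i ∈ J
        · exact h2 i hi
        · simp [hJ i hi]
    · intro i hi
      rw [Finset.notMem_union] at hi
      simp [hI i hi.1, hJ i hi.2]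
  refine hpi.tendsto_probabilityMeasure_of_tendsto_of_mem ?_ ?_ ?_
  · rintro _ ⟨I, s, rfl, -, hs, -⟩
    exact MeasurableSet.pi I.countable_toSet fun i _ => hs i
  · intro u hu x hx
    obtain ⟨I, v, hv, hvu⟩ := isOpen_pi_iff.1 hu x hx
    have hr : ∀ i : ℕ, ∃ s : Set X, IsOpen s ∧ x i ∈ s ∧ (i ∈ I → s ⊆ v i) ∧
        (i ∉ I → s = Set.univ) ∧ (P θ : Measure X) (frontier s) = 0 := by
      intro i
      by_cases hi : i ∈ I
      · obtain ⟨ε, hε, hεv⟩ := Metric.isOpen_iff.1 (hv i hi).1 (x i) (hv i hi).2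
        -- Balls about `x i` have disjoint bounding frontiers for different radii, so some radius
        -- below `ε` gives a null frontier.
        obtain ⟨r, hr, hr0⟩ := exists_null_frontier_thickening (P θ : Measure X) {x i} hε
        rw [Metric.thickening_singleton] at hr0
        exact ⟨Metric.ball (x i) r, Metric.isOpen_ball, Metric.mem_ball_self hr.1,
          fun _ => (Metric.ball_subset_ball hr.2.le).trans hεv, fun h => absurd hi h, hr0⟩
      · exact ⟨Set.univ, isOpen_univ, Set.mem_univ _, fun h => absurd h hi, fun _ => rfl, by simp⟩
    choose s hso hxs hsv hsu hs0 using hr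
    refine ⟨Set.pi I s, ⟨I, s, rfl, hsu, fun i => (hso i).measurableSet, hs0⟩,
      (isOpen_set_pi I.finite_toSet fun i _ => hso i).mem_nhds fun i _ => hxs i, ?_⟩
    exact (Set.pi_mono fun i hi => hsv i hi).trans hvu
  · rintro _ ⟨I, s, rfl, -, hs, hs0⟩
    have hval : ∀ t : S, infinitePower (P t) (Set.pi I s) = ∏ i ∈ I, P t (s i) := by
      intro t
      rw [← ENNReal.coe_inj, ProbabilityMeasure.ennreal_coeFn_eq_coeFn_toMeasure]
      refine (Measure.infinitePi_pi (fun _ : ℕ => (P t : Measure X)) fun i _ => hs i).trans ?_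
      simp
    simp only [hval]
    refine tendsto_finsetProd _ fun i _ => ?_
    exact ProbabilityMeasure.tendsto_measure_of_null_frontier_of_tendsto hP.continuousAt
      (by rw [ProbabilityMeasure.null_iff_toMeasure_null]; exact hs0 i)

/-- The expectation of `f` under `P θ ^ ∞`, as a bounded continuous function of `θ`. -/
noncomputable def seqExpectation [TopologicalSpace Θ] [FirstCountableTopology Θ]
    [SecondCountableTopology X] [TopologicalSpace.PseudoMetrizableSpace X]
    (P : Θ → ProbabilityMeasure X) (hP : Measurable P) (hcont : Continuous P)
    (f : (ℕ → X) →ᵇ ℝ) : Θ →ᵇ ℝ :=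
  BoundedContinuousFunction.ofNormedAddCommGroup (fun θ => ∫ y, f y ∂(seqKernel P hP θ))
    (continuous_iff_continuousAt.2 fun _ =>
      ProbabilityMeasure.tendsto_iff_forall_integral_tendsto.1
        (continuous_infinitePower hcont).continuousAt f)
    ‖f‖ fun _ => f.norm_integral_le_norm _

theorem integral_predictive [SecondCountableTopology X]
    (P : Θ → ProbabilityMeasure X) (hP : Measurable P) (ν : Measure Θ) [IsFiniteMeasure ν]
    (f : (ℕ → X) →ᵇ ℝ) :
    ∫ y, f y ∂(predictive P hP ν) = ∫ θ, ∫ y, f y ∂(seqKernel P hP θ) ∂ν := by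
  have hsnd : predictive P hP ν = (ν ⊗ₘ seqKernel P hP).map Prod.snd :=
    (Measure.snd_compProd ν (seqKernel P hP)).symm
  rw [hsnd, integral_map measurable_snd.aemeasurable
    f.continuous.measurable.aestronglyMeasurable, Measure.integral_compProd]
  exact (integrable_map_measure f.continuous.measurable.aestronglyMeasurable
    measurable_snd.aemeasurable).1 (f.integrable _)

/-- The bounded continuous function `x ↦ (h x₀ - c) (h x₁ - c)`. -/
noncomputable def centeredProduct (h : X →ᵇ ℝ) (c : ℝ) : (ℕ → X) →ᵇ ℝ :=
  (h - BoundedContinuousFunction.const X c).compContinuous ⟨fun x => x 0, continuous_apply 0⟩ *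
  (h - BoundedContinuousFunction.const X c).compContinuous ⟨fun x => x 1, continuous_apply 1⟩

theorem integral_centeredProduct [SecondCountableTopology X]
    (P : Θ → ProbabilityMeasure X) (hP : Measurable P) (h : X →ᵇ ℝ) (c : ℝ) (θ : Θ) :
    ∫ y, centeredProduct h c y ∂(seqKernel P hP θ) =
      (∫ x, h x ∂(P θ : Measure X) - c) ^ 2 := by
  have hm : Measurable fun x : X × X => (h x.1 - c) * (h x.2 - c) := by
    have := h.continuous.measurable
    fun_prop
  calc ∫ y, centeredProduct h c y ∂(seqKernel P hP θ)
      = ∫ y, (fun x : X × X => (h x.1 - c) * (h x.2 - c)) (y 0, y 1) ∂(seqKernel P hP θ) := rfl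
    _ = ∫ x, (h x.1 - c) * (h x.2 - c) ∂((P θ : Measure X).prod (P θ : Measure X)) := by
        rw [← Measure.infinitePi_map_eval_prod (P := fun _ : ℕ => (P θ : Measure X)) zero_ne_one,
          integral_map (by fun_prop) hm.aestronglyMeasurable]
        rfl
    _ = (∫ x, h x ∂(P θ : Measure X) - c) ^ 2 := by
        rw [integral_prod_mul (fun x => h x - c) fun x => h x - c,
          integral_sub (h.integrable _) (integrable_const _)]
        simp [sq]

end Predictive

/-! ### From convergence of integrals back to consistency. -/

section Equivalence

variable {Θ X : Type*} [TopologicalSpace Θ] [PolishSpace Θ] [MeasurableSpace Θ] [BorelSpace Θ]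
  [MeasurableSpace X]

theorem tendsto_abs_sub_zero {u v : ℕ → ℝ} {a : ℝ} (hu : Tendsto u atTop (𝓝 a))
    (hv : Tendsto v atTop (𝓝 a)) : Tendsto (fun n => |u n - v n|) atTop (𝓝 0) := by
  simpa using (hu.sub hv).abs

theorem tendsto_of_abs_sub_zero {u v : ℕ → ℝ} {a : ℝ}
    (h : Tendsto (fun n => |u n - v n|) atTop (𝓝 0)) (hv : Tendsto v atTop (𝓝 a)) :
    Tendsto u atTop (𝓝 a) := by
  simpa using (tendsto_zero_iff_abs_tendsto_zero _ |>.2 h).add hv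

/-- A Urysohn function vanishing at `θ` and equal to one off `interior W` bounds the mass of `Wᶜ`.
Only one test function is used per `W`, so the null set in `h` may depend on `g`. -/
theorem weaklyConsistentAt_of_tendsto_integral (P : Θ → ProbabilityMeasure X) (hP : Measurable P)
    {post : ∀ n : ℕ, (Fin n → X) → Measure Θ} {θ : Θ}
    (hprob : ∀ᵐ x ∂(seqKernel P hP θ),
      ∀ᶠ n in atTop, IsProbabilityMeasure (post n (initialData n x)))
    (h : ∀ g : Θ →ᵇ ℝ, ∀ᵐ x ∂(seqKernel P hP θ),
      Tendsto (fun n => ∫ t, g t ∂(post n (initialData n x))) atTop (𝓝 (g θ))) :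
    WeaklyConsistentAt P hP post θ := by
  intro W hW
  let : MetricSpace Θ := TopologicalSpace.metrizableSpaceMetric Θ
  obtain ⟨f, hf0, hf1, hf⟩ := exists_continuous_zero_one_of_isClosed (isClosed_singleton (x := θ))
    isOpen_interior.isClosed_compl (s := {θ}) (t := (interior W)ᶜ)
    (Set.disjoint_singleton_left.2 (by simpa using mem_interior_iff_mem_nhds.2 hW))
  let g : Θ →ᵇ ℝ := BoundedContinuousFunction.ofNormedAddCommGroup f f.continuous 1 fun t => by
    rw [Real.norm_eq_abs, abs_of_nonneg (hf t).1]
    exact (hf t).2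
  have hgθ : g θ = 0 := hf0 rfl
  filter_upwards [hprob, h g] with x hx hgx
  rw [hgθ] at hgx
  refine tendsto_measure_zero_of_tendsto_integral hx g (fun t => (hf t).1) one_pos (fun t ht => ?_)
    hgx
  exact (hf1 (fun h => ht (interior_subset h))).ge

/-- If `P` is inducing, convergence of the predictive expectations of bounded continuous functions
forces consistency of the distributions of the parameter. -/
theorem weaklyConsistentAt_of_tendsto_integral_seqKernel
    [TopologicalSpace X] [PolishSpace X] [BorelSpace X]
    (P : Θ → ProbabilityMeasure X) (hP : Measurable P) (hind : IsInducing P)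
    {post : ∀ n : ℕ, (Fin n → X) → Measure Θ} {θ : Θ}
    (hprob : ∀ᵐ x ∂(seqKernel P hP θ),
      ∀ᶠ n in atTop, IsProbabilityMeasure (post n (initialData n x)))
    (h : ∀ f : (ℕ → X) →ᵇ ℝ, ∀ᵐ x ∂(seqKernel P hP θ),
      Tendsto (fun n => ∫ t, seqExpectation P hP hind.continuous f t ∂(post n (initialData n x)))
        atTop (𝓝 (∫ y, f y ∂(seqKernel P hP θ)))) :
    WeaklyConsistentAt P hP post θ := by
  -- The sets carrying asymptotically full mass, almost surely, form a filter, and consistency says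
  -- `l ≤ 𝓝 θ`. As `P` is inducing, this is `Tendsto P l (𝓝 (P θ))`, which can be tested on one `k`
  -- and one `ε` at a time.
  let l : Filter Θ :=
    { sets := {W | ∀ᵐ x ∂(seqKernel P hP θ),
        Tendsto (fun n => post n (initialData n x) Wᶜ) atTop (𝓝 0)}
      univ_sets := by simp
      sets_of_superset := fun {V W} hV hVW => by
        change ∀ᵐ x ∂(seqKernel P hP θ), Tendsto _ _ _
        change ∀ᵐ x ∂(seqKernel P hP θ), Tendsto _ _ _ at hV
        filter_upwards [hV] with x hx
        exact tendsto_of_tendsto_of_tendsto_of_le_of_le tendsto_const_nhds hx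
          (fun _ => zero_le) fun n => measure_mono (Set.compl_subset_compl.2 hVW)
      inter_sets := fun {V W} hV hW => by
        change ∀ᵐ x ∂(seqKernel P hP θ), Tendsto _ _ _
        change ∀ᵐ x ∂(seqKernel P hP θ), Tendsto _ _ _ at hV hW
        filter_upwards [hV, hW] with x hx hx'
        have hadd := hx.add hx'
        rw [add_zero] at hadd
        refine tendsto_of_tendsto_of_tendsto_of_le_of_le tendsto_const_nhds hadd
          (fun _ => zero_le) fun n => ?_
        rw [Set.compl_inter]
        exact measure_union_le _ _ }
  have hl : Tendsto P l (𝓝 (P θ)) := by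
    refine ProbabilityMeasure.tendsto_iff_forall_integral_tendsto.2 fun k => ?_
    rw [Metric.tendsto_nhds]
    intro ε hε
    set c := ∫ x, k x ∂(P θ : Measure X)
    have hval : ∀ t, seqExpectation P hP hind.continuous (centeredProduct k c) t =
        (∫ x, k x ∂(P t : Measure X) - c) ^ 2 := integral_centeredProduct P hP k c
    change ∀ᵐ x ∂(seqKernel P hP θ), Tendsto _ atTop (𝓝 0)
    filter_upwards [hprob, h (centeredProduct k c)] with x hx hgx
    rw [integral_centeredProduct, sub_self, zero_pow two_ne_zero] at hgx
    refine tendsto_measure_zero_of_tendsto_integral hx _ (fun t => ?_) (pow_pos hε 2)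
      (fun t ht => ?_) hgx
    · rw [hval]; positivity
    · rw [hval, ← sq_abs (_ - c)]
      exact pow_le_pow_left₀ hε.le (not_lt.1 ht) 2
  intro W hW
  rw [hind.nhds_eq_comap] at hW
  exact (tendsto_iff_comap.1 hl) hW

end Equivalence

end EmpiricalBayes

/-! ### The equivalences. -/

theorem mainTheorem2
    {Θ X L : Type*}
    [TopologicalSpace Θ] [PolishSpace Θ] [MeasurableSpace Θ] [BorelSpace Θ] [Nonempty Θ]
    [TopologicalSpace X] [PolishSpace X] [MeasurableSpace X] [BorelSpace X]
    [TopologicalSpace L]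
    -- the model, with `θ ↦ P θ` one-to-one and Borel
    (P : Θ → ProbabilityMeasure X) (hP : Measurable P) (hinj : Function.Injective P)
    -- the family of priors, indexed by `Λ`
    (Λ : Set L) (Pr : Λ → ProbabilityMeasure Θ)
    -- for each hyperparameter value with a prior, a version of the corresponding posterior
    (post : ∀ n : ℕ, closure Λ → (Fin n → X) → Measure Θ)
    (hpost : ∀ (n : ℕ) (l : closure Λ) (ν : ProbabilityMeasure Θ), IsPriorAt Λ Pr l ν →
      IsPosteriorVersion P hP (ν : Measure Θ) n (post n l))
    -- the estimator of the hyperparameter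
    (lhat : ∀ n : ℕ, (Fin n → X) → closure Λ)
    (hmeas : ∀ n : ℕ, Measurable (ebPosterior post lhat n))
    -- the empirical Bayes posterior is well defined
    (hwell : ∀ θ : Θ, ∀ᵐ x ∂(seqKernel P hP θ), ∀ᶠ n in atTop,
      (∃ ν : ProbabilityMeasure Θ, IsPriorAt Λ Pr (lhat n (initialData n x)) ν) ∧
        IsProbabilityMeasure (ebPosterior post lhat n (initialData n x))) :
    ((∀ θ : Θ, WeaklyConsistentAt P hP (ebPosterior post lhat) θ) ↔
      ∀ (q : Measure Θ) [IsProbabilityMeasure q], ∀ᵐ z ∂(jointLaw P hP q),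
        WeaklyMerge (fun n => ebPosterior post lhat n (initialData n z.2))
          (fun n => bayesPosterior P hP q n (initialData n z.2))) ∧
    (IsEmbedding P →
      ((∀ θ : Θ, WeaklyConsistentAt P hP (ebPosterior post lhat) θ) ↔
        ∀ (q : Measure Θ) [IsProbabilityMeasure q], ∀ᵐ z ∂(jointLaw P hP q),
          WeaklyMerge (fun n => predictive P hP (ebPosterior post lhat n (initialData n z.2)))
            (fun n => predictive P hP (bayesPosterior P hP q n (initialData n z.2)))) ∧
      ((∀ θ : Θ, WeaklyConsistentAt P hP (ebPosterior post lhat) θ) ↔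
        ∀ (q : Measure Θ) [IsProbabilityMeasure q] (f : (ℕ → X) →ᵇ ℝ),
          ∀ᵐ z ∂(jointLaw P hP q), Tendsto (fun n =>
            |∫ y, f y ∂(predictive P hP (ebPosterior post lhat n (initialData n z.2))) -
              ∫ y, f y ∂(predictive P hP (bayesPosterior P hP q n (initialData n z.2)))|)
            atTop (𝓝 0))) := by
  have hprob : ∀ θ : Θ, ∀ᵐ x ∂(seqKernel P hP θ), ∀ᶠ n in atTop,
      IsProbabilityMeasure (ebPosterior post lhat n (initialData n x)) := fun θ => by
    filter_upwards [hwell θ] with x hx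
    exact hx.mono fun n hn => hn.2
  have hbayes : ∀ (q : Measure Θ) [IsProbabilityMeasure q], ∀ᵐ z ∂(jointLaw P hP q),
      ∀ g : Θ →ᵇ ℝ, Tendsto (fun n => ∫ t, g t ∂(bayesPosterior P hP q n (initialData n z.2)))
        atTop (𝓝 (g z.1)) := fun q _ => by
    filter_upwards [ae_concentratesAt_bayesPosterior P hP hinj q] with z hz g
    exact hz.tendsto_integral (Eventually.of_forall fun n => inferInstance) g
  have heb : (∀ θ : Θ, WeaklyConsistentAt P hP (ebPosterior post lhat) θ) →
      ∀ (q : Measure Θ) [IsProbabilityMeasure q], ∀ᵐ z ∂(jointLaw P hP q),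
      ∀ g : Θ →ᵇ ℝ, Tendsto (fun n => ∫ t, g t ∂(ebPosterior post lhat n (initialData n z.2)))
        atTop (𝓝 (g z.1)) := fun hcons q _ => by
    filter_upwards [ae_concentratesAt_of_weaklyConsistentAt P hP q hmeas hcons,
      ae_eventually_isProbabilityMeasure P hP q hmeas hprob] with z hz hz' g
    exact hz.tendsto_integral hz' g
  refine ⟨⟨fun hcons q _ => ?_, fun hmerge θ => ?_⟩, fun hemb => ?_⟩
  · filter_upwards [hbayes q, heb hcons q] with z h1 h2 g
    exact tendsto_abs_sub_zero (h2 g) (h1 g)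
  · refine weaklyConsistentAt_of_tendsto_integral P hP (hprob θ) fun g => ?_
    -- With prior `dirac θ` the Bayes integrals tend to `g θ`, and merging passes this limit to the
    -- EB integrals.
    filter_upwards [ae_seqKernel_of_ae_jointLaw_dirac P hP θ (hbayes (Measure.dirac θ)),
      ae_seqKernel_of_ae_jointLaw_dirac P hP θ (hmerge (Measure.dirac θ))] with x h1 h2
    exact tendsto_of_abs_sub_zero (h2 g) (h1 g)
  have hpred : ∀ (f : (ℕ → X) →ᵇ ℝ) (ν : Measure Θ) [IsFiniteMeasure ν],
      ∫ y, f y ∂(predictive P hP ν) = ∫ t, seqExpectation P hP hemb.continuous f t ∂ν :=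
    fun f ν _ => integral_predictive P hP ν f
  have hpredBayes : ∀ (q : Measure Θ) [IsProbabilityMeasure q], ∀ᵐ z ∂(jointLaw P hP q),
      ∀ f : (ℕ → X) →ᵇ ℝ, Tendsto
        (fun n => ∫ y, f y ∂(predictive P hP (bayesPosterior P hP q n (initialData n z.2)))) atTop
        (𝓝 (seqExpectation P hP hemb.continuous f z.1)) := fun q _ => by
    filter_upwards [hbayes q] with z hz f
    simpa only [hpred] using hz (seqExpectation P hP hemb.continuous f)
  have hab : (∀ θ : Θ, WeaklyConsistentAt P hP (ebPosterior post lhat) θ) →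
      ∀ (q : Measure Θ) [IsProbabilityMeasure q], ∀ᵐ z ∂(jointLaw P hP q),
        WeaklyMerge (fun n => predictive P hP (ebPosterior post lhat n (initialData n z.2)))
          (fun n => predictive P hP (bayesPosterior P hP q n (initialData n z.2))) :=
    fun hcons q _ => by
      filter_upwards [hpredBayes q, heb hcons q,
        ae_eventually_isProbabilityMeasure P hP q hmeas hprob] with z h1 h2 h3 f
      refine tendsto_abs_sub_zero
        ((h2 (seqExpectation P hP hemb.continuous f)).congr' ?_) (h1 f)
      -- `hpred` needs a finite measure, which the EB posterior is known to be only for large `n`.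
      filter_upwards [h3] with n hn
      exact (hpred f _).symm
  have hca : (∀ (q : Measure Θ) [IsProbabilityMeasure q] (f : (ℕ → X) →ᵇ ℝ),
          ∀ᵐ z ∂(jointLaw P hP q), Tendsto (fun n =>
            |∫ y, f y ∂(predictive P hP (ebPosterior post lhat n (initialData n z.2))) -
              ∫ y, f y ∂(predictive P hP (bayesPosterior P hP q n (initialData n z.2)))|)
            atTop (𝓝 0)) →
      ∀ θ : Θ, WeaklyConsistentAt P hP (ebPosterior post lhat) θ := fun hmerge θ => by
    refine weaklyConsistentAt_of_tendsto_integral_seqKernel P hP hemb.isInducing (hprob θ)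
      fun f => ?_
    filter_upwards [ae_seqKernel_of_ae_jointLaw_dirac P hP θ (hpredBayes (Measure.dirac θ)),
      ae_seqKernel_of_ae_jointLaw_dirac P hP θ (hmerge (Measure.dirac θ) f), hprob θ]
      with x h1 h2 h3
    refine (tendsto_of_abs_sub_zero h2 (h1 f)).congr' ?_
    filter_upwards [h3] with n hn
    exact hpred f _
  have hbc : (∀ (q : Measure Θ) [IsProbabilityMeasure q], ∀ᵐ z ∂(jointLaw P hP q),
        WeaklyMerge (fun n => predictive P hP (ebPosterior post lhat n (initialData n z.2)))
          (fun n => predictive P hP (bayesPosterior P hP q n (initialData n z.2)))) →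
      ∀ (q : Measure Θ) [IsProbabilityMeasure q] (f : (ℕ → X) →ᵇ ℝ),
          ∀ᵐ z ∂(jointLaw P hP q), Tendsto (fun n =>
            |∫ y, f y ∂(predictive P hP (ebPosterior post lhat n (initialData n z.2))) -
              ∫ y, f y ∂(predictive P hP (bayesPosterior P hP q n (initialData n z.2)))|)
            atTop (𝓝 0) := fun h q _ f => by
    filter_upwards [h q] with z hz using hz f
  exact ⟨⟨hab, fun h => hca (hbc h)⟩, fun h => hbc (hab h), hca⟩
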